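/- Let $[k]=(q^{k}-q^{-k})/(q-q^{-1})$. For $n\ge 0$ let $\mathrm{TL}^{D}_{n+1}$ be the unital associative $\mathbb{C}(q)$-algebra with generators $E_0,E_1,\ldots,E_n$ and relations $E_a^2=-[2]E_a$; $E_aE_bE_a=E_a$ if $a,b$ are adjacent in the Dynkin diagram $D_{n+1}$; $E_aE_b=E_bE_a$ otherwise. Here $D_{n+1}$ has nodes $0,1,\ldots,n$ and edges $\{0,2\}$ and $\{k,k+1\}$ for $1\le k\le n-1$ (the edge $\{0,2\}$ only if $n\ge 2$). For $m\le n$, elements of $\mathrm{TL}^{D}_{m+1}$ are regarded as elements of $\mathrm{TL}^{D}_{n+1}$ via $E_a\mapsto E_a$. There is a unique sequence of elements $Q_n\in \mathrm{TL}^{D}_{n+1}$, $n\ge 0$ (the Jones--Wenzl projections of type $D$) such that for all $n$: $Q_n\ne 0$; $Q_nQ_m=Q_mQ_n=Q_n$ for $0\le m\le n$; and $E_aQ_n=Q_nE_a=0$ for $0\le a\le n$. A word $E_{s_1}\cdots E_{s_l}$ is called a reduced expression if it is not equal to a scalar multiple of a word with fewer than $l$ generators. The coefficient of an element given by a reduced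 expression in an element $x$ of $\mathrm{TL}^{D}_{n+1}$ is its coefficient when $x$ is written as a linear combination of the (distinct) elements given by reduced expressions. Let $1\le i\le j\le n$. Then $E_jE_{j-1}\cdots E_i$ is a reduced expression, its coefficient $\mathrm{coef}^{n}(E_jE_{j-1}\cdots E_i)$ in $Q_n$ is well defined, and $$\mathrm{coef}^{n}(E_jE_{j-1}\cdots E_i)=\begin{cases}\dfrac{[n][n+1]}{[2n][2]}, & i=j=1,\\[8pt] \dfrac{[n][n+1-j]}{[2n]}, & i=1<j,\\[8pt] \dfrac{[n][2(i-1)][n+1-j]}{[2n][i-1]}, & i\ge 2.\end{cases}$$ -/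

import Mathlib

/-! The Temperley–Lieb algebra of type `D`, its monomials, and its Jones–Wenzl projections. -/

namespace TypeD

/-- The field `ℂ(q)` of rational functions in one indeterminate. -/
abbrev K : Type := RatFunc ℂ

/-- The indeterminate `q` of `ℂ(q)`. -/
noncomputable def q : K := RatFunc.X

/-- The `q`-integer `[k] = (q^k - q^(-k)) / (q - q^(-1))`. -/
noncomputable def qInt (k : ℤ) : K := (q ^ k - q ^ (-k)) / (q - q⁻¹)

/-- The Dynkin diagram `D_{n+1}` on the nodes `0, 1, …, n`: the node `2` is joined to both `0`
and `1`, and `k` is joined to `k + 1` for `k ≥ 2`. -/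
def dynkin (n : ℕ) : SimpleGraph (Fin (n + 1)) :=
  SimpleGraph.fromRel fun a b =>
    (a.val = 0 ∧ b.val = 2) ∨ (1 ≤ a.val ∧ b.val = a.val + 1)

/-- The defining relations of the Temperley–Lieb algebra of type `D_{n+1}`. -/
inductive Rel (n : ℕ) : FreeAlgebra K (Fin (n + 1)) → FreeAlgebra K (Fin (n + 1)) → Prop
  | sq (i : Fin (n + 1)) :
      Rel n (FreeAlgebra.ι K i * FreeAlgebra.ι K i) (-(qInt 2 • FreeAlgebra.ι K i))
  | braid (i j : Fin (n + 1)) (h : (dynkin n).Adj i j) :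
      Rel n (FreeAlgebra.ι K i * FreeAlgebra.ι K j * FreeAlgebra.ι K i) (FreeAlgebra.ι K i)
  | comm (i j : Fin (n + 1)) (h : ¬ (dynkin n).Adj i j) :
      Rel n (FreeAlgebra.ι K i * FreeAlgebra.ι K j) (FreeAlgebra.ι K j * FreeAlgebra.ι K i)

/-- The Temperley–Lieb algebra of type `D_{n+1}` over `ℂ(q)`, with generators `E_0, …, E_n`. -/
abbrev TL (n : ℕ) : Type := RingQuot (Rel n)

/-- The generator `E_i`. -/
noncomputable def E {n : ℕ} (i : Fin (n + 1)) : TL n :=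
  RingQuot.mkAlgHom K (Rel n) (FreeAlgebra.ι K i)

theorem E_sq {n : ℕ} (i : Fin (n + 1)) : E i * E i = -(qInt 2 • E i) := by
  have h := RingQuot.mkAlgHom_rel K (Rel.sq i)
  simpa only [E, map_mul, map_neg, map_smul] using h

theorem E_braid {n : ℕ} {i j : Fin (n + 1)} (hij : (dynkin n).Adj i j) :
    E i * E j * E i = E i := by
  have h := RingQuot.mkAlgHom_rel K (Rel.braid i j hij)
  simpa only [E, map_mul] using h

theorem E_comm {n : ℕ} {i j : Fin (n + 1)} (hij : ¬ (dynkin n).Adj i j) :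
    E i * E j = E j * E i := by
  have h := RingQuot.mkAlgHom_rel K (Rel.comm i j hij)
  simpa only [E, map_mul] using h

theorem dynkin_castLE {m n : ℕ} (h : m + 1 ≤ n + 1) (i j : Fin (m + 1)) :
    (dynkin n).Adj (Fin.castLE h i) (Fin.castLE h j) ↔ (dynkin m).Adj i j := by
  simp only [dynkin, SimpleGraph.fromRel_adj, ne_eq, Fin.ext_iff, Fin.val_castLE]

/-- The canonical homomorphism from the algebra of type `D_{m+1}` to that of type `D_{n+1}`,
`m ≤ n`, sending `E_i` to `E_i`. -/
noncomputable def incl {m n : ℕ} (h : m ≤ n) : TL m →ₐ[K] TL n :=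
  RingQuot.liftAlgHom K (s := Rel m)
    ⟨FreeAlgebra.lift K fun i : Fin (m + 1) =>
        (E (Fin.castLE (Nat.succ_le_succ h) i) : TL n), by
      intro x y hxy
      cases hxy with
      | sq i => simpa using E_sq (Fin.castLE (Nat.succ_le_succ h) i)
      | braid i j hij =>
        simpa using E_braid ((dynkin_castLE (Nat.succ_le_succ h) i j).2 hij)
      | comm i j hij =>
        simpa using E_comm (fun hc => hij ((dynkin_castLE (Nat.succ_le_succ h) i j).1 hc))⟩

theorem incl_E {m n : ℕ} (h : m ≤ n) (i : Fin (m + 1)) :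
    incl h (E i) = E (Fin.castLE (Nat.succ_le_succ h) i) := by
  simp [incl, E]

/-- `Q 0, Q 1, Q 2, …` are Jones–Wenzl projections of type `D`, with `Q n` in the algebra of
type `D_{n+1}`. Smaller algebras act on larger ones through `incl`. -/
structure IsJonesWenzl (Q : ∀ n : ℕ, TL n) : Prop where
  ne_zero : ∀ n, Q n ≠ 0
  mul_incl : ∀ (n i : ℕ) (h : i ≤ n), Q n * incl h (Q i) = Q n
  incl_mul : ∀ (n i : ℕ) (h : i ≤ n), incl h (Q i) * Q n = Q n
  E_mul : ∀ (n : ℕ) (i : Fin (n + 1)), E i * Q n = 0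
  mul_E : ∀ (n : ℕ) (i : Fin (n + 1)), Q n * E i = 0

/-- The word `E_w = E_{s_1} ⋯ E_{s_l}` attached to a sequence `w = (s_1, …, s_l)`. -/
noncomputable def word {n : ℕ} (w : List (Fin (n + 1))) : TL n := (w.map E).prod

/-- `E_w` is a reduced expression: it cannot be written, up to a scalar, with fewer generators. -/
def IsReduced {n : ℕ} (w : List (Fin (n + 1))) : Prop :=
  ∀ (v : List (Fin (n + 1))) (c : K), word w = c • word v → w.length ≤ v.length

/-- The elements of the algebra that are given by reduced expressions (the monomial basis). -/
def monomials (n : ℕ) : Set (TL n) := {m | ∃ w, IsReduced w ∧ word w = m}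

/-- The coefficient of `m` in `x` is `c`: the element `x` is a linear combination of the elements
given by reduced expressions, `m` is one of these elements, and in every such linear combination
the coefficient of `m` is `c`. -/
def HasCoef {n : ℕ} (x m : TL n) (c : K) : Prop :=
  m ∈ monomials n ∧
  (∃ f ∈ Finsupp.supported K K (monomials n), Finsupp.linearCombination K id f = x) ∧
  ∀ f ∈ Finsupp.supported K K (monomials n), Finsupp.linearCombination K id f = x → f m = c

/-- The sequence `(j, j - 1, …, i)`, for `i ≤ j ≤ n`. -/
def descending {n : ℕ} (i j : ℕ) (hj : j ≤ n) : List (Fin (n + 1)) :=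
  List.ofFn fun k : Fin (j + 1 - i) => ⟨j - k.val, by omega⟩

end TypeD

namespace TypeD

/-! ### The field -/

/-! Existence. The elements `T a = E_a + q` satisfy the braid relations, and `E_a (1 + q T_a) = 0`.
If `P` is killed on the left by the generators of the smaller diagram, then the sum of `q^ℓ(d) T_d
P` over the minimal coset representatives `d` is killed by all generators of the next one
(`EN_mul_cosetSum`). Its augmentation is a Poincaré polynomial times that of `P`, hence nonzero.
Multiplying by the image under the anti-involution makes it two-sided. Uniqueness follows because a
killed element spans a trivial module.

Coefficients. For fixed `i`, the algebra acts on the span of a vector `(1, 0)` and one vector `e_a`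
per node: `E_a` is a rank one operator onto `e_a`, and among the monomials only the path products
ending at `E_i` are seen by `(1, 0)`. Hence the `e_j`-coordinate of `x (1, 0)` is a linear
functional equal to 1 on `E_j ⋯ E_i` and to 0 on every other monomial (`coefFun_monomial`), so the
coefficient is well defined without knowing that the monomials are independent. If `y` is column `i`
of the inverse of `[2] - adjacency`, then every `E_a` kills `(1, y)`, so `Q` fixes it; but `Q` kills
every `e_a`, so `Q (1, 0) = (1, y)` and the coefficient is `y j` (`coefFun_eq_of_killed`). It
remains to invert the `q`-Cartan matrix of type `D` (`coeffFun_column_one`, `coeffFun_column`). -/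

theorem q_ne_zero : q ≠ 0 := RatFunc.X_ne_zero

theorem q_pow_ne_C {m : ℕ} (hm : 0 < m) (c : ℂ) : q ^ m ≠ RatFunc.C c := by
  intro h
  have h1 : algebraMap (Polynomial ℂ) K (Polynomial.X ^ m - Polynomial.C c) = 0 := by
    rw [map_sub, map_pow, RatFunc.algebraMap_X, RatFunc.algebraMap_C, sub_eq_zero]
    exact h
  exact RatFunc.algebraMap_ne_zero (Polynomial.X_pow_sub_C_ne_zero hm c) h1

theorem q_sub_inv_ne_zero : q - q⁻¹ ≠ 0 := by
  intro h
  have h0 := q_ne_zero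
  have h2 : q ^ 2 = 1 := by
    field_simp at h
    linear_combination h
  exact q_pow_ne_C two_pos 1 (by rw [h2, map_one])

theorem q_pow_add_inv_ne_zero (n : ℕ) : q ^ n + (q ^ n)⁻¹ ≠ 0 := by
  intro h
  have h0 := pow_ne_zero n q_ne_zero
  have h2 : q ^ (2 * n) = -1 := by
    rw [mul_comm, pow_mul]
    field_simp at h
    linear_combination h
  rcases Nat.eq_zero_or_pos n with rfl | hn
  · norm_num at h2
  · exact q_pow_ne_C (by omega : 0 < 2 * n) (-1) (by rw [h2, map_neg, map_one])

theorem q_pow_sub_inv_ne_zero {n : ℕ} (hn : 0 < n) : q ^ n - (q ^ n)⁻¹ ≠ 0 := by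
  intro h
  have h0 := pow_ne_zero n q_ne_zero
  have h2 : q ^ (2 * n) = 1 := by
    rw [mul_comm, pow_mul]
    field_simp at h
    linear_combination h
  exact q_pow_ne_C (by omega : 0 < 2 * n) 1 (by rw [h2, map_one])

theorem qInt_two : qInt 2 = q + q⁻¹ := by
  have h := q_sub_inv_ne_zero
  rw [qInt, div_eq_iff h, zpow_neg, show (2 : ℤ) = ((2 : ℕ) : ℤ) from rfl, zpow_natCast]
  have := q_ne_zero
  field_simp
  ring

theorem qInt_two_ne_zero : qInt 2 ≠ 0 := by
  rw [qInt_two]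
  simpa using q_pow_add_inv_ne_zero 1

/-! ### Generators indexed by natural numbers -/

/-- Adjacency in the infinite diagram `D_∞` with nodes `0, 1, 2, …`. -/
def AdjN (a b : ℕ) : Prop :=
  (a = 0 ∧ b = 2) ∨ (b = 0 ∧ a = 2) ∨ (1 ≤ a ∧ b = a + 1) ∨ (1 ≤ b ∧ a = b + 1)

instance (a b : ℕ) : Decidable (AdjN a b) := by unfold AdjN; infer_instance

theorem AdjN.symm {a b : ℕ} (h : AdjN a b) : AdjN b a := by
  unfold AdjN at *; omega

theorem dynkin_adj {n : ℕ} (a b : Fin (n + 1)) : (dynkin n).Adj a b ↔ AdjN a b := by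
  simp only [dynkin, SimpleGraph.fromRel_adj, ne_eq, Fin.ext_iff, AdjN]
  omega

/-- The generator `E_k`, with the convention `E_k = 0` for `k > n`. -/
noncomputable def EN (n k : ℕ) : TL n := if h : k < n + 1 then E ⟨k, h⟩ else 0

theorem EN_of_lt {n k : ℕ} (h : k < n + 1) : EN n k = E ⟨k, h⟩ := dif_pos h

theorem E_eq_EN {n : ℕ} (a : Fin (n + 1)) : E a = EN n a := (EN_of_lt a.2).symm

theorem EN_sq (n a : ℕ) : EN n a * EN n a = -(qInt 2 • EN n a) := by
  unfold EN
  split_ifs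
  · exact E_sq _
  · simp

/-- Only `b` needs a bound: for `a > n` both sides are 0, while `b > n` would make only the left
side vanish. -/
theorem EN_braid {n a b : ℕ} (h : AdjN a b) (hb : b ≤ n) :
    EN n a * EN n b * EN n a = EN n a := by
  by_cases ha : a < n + 1
  · rw [EN_of_lt ha, EN_of_lt (Nat.lt_succ_of_le hb)]
    exact E_braid ((dynkin_adj _ _).2 h)
  · simp [EN, ha]

theorem EN_comm {n a b : ℕ} (h : ¬ AdjN a b) : EN n a * EN n b = EN n b * EN n a := by
  by_cases ha : a < n + 1
  · by_cases hb : b < n + 1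
    · rw [EN_of_lt ha, EN_of_lt hb]
      exact E_comm fun hc => h ((dynkin_adj _ _).1 hc)
    · simp [EN, hb]
  · simp [EN, ha]

/-! ### Induction, the augmentation and the anti-involution -/

theorem TL_induction {n : ℕ} {C : TL n → Prop} (scalar : ∀ c : K, C (algebraMap K (TL n) c))
    (gen : ∀ a, C (E a)) (mul : ∀ x y, C x → C y → C (x * y))
    (add : ∀ x y, C x → C y → C (x + y)) (x : TL n) : C x := by
  obtain ⟨y, rfl⟩ := RingQuot.mkAlgHom_surjective K (Rel n) x
  induction y using FreeAlgebra.induction with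
  | grade0 r => rw [AlgHom.commutes]; exact scalar r
  | grade1 a => exact gen a
  | mul a b ha hb => rw [map_mul]; exact mul _ _ ha hb
  | add a b ha hb => rw [map_add]; exact add _ _ ha hb

theorem algHom_ext {n : ℕ} {A : Type*} [Semiring A] [Algebra K A] {f g : TL n →ₐ[K] A}
    (h : ∀ a, f (E a) = g (E a)) : f = g := by
  refine AlgHom.ext fun x => ?_
  induction x using TL_induction with
  | scalar c => simp
  | gen a => exact h a
  | mul x y hx hy => rw [map_mul, map_mul, hx, hy]
  | add x y hx hy => rw [map_add, map_add, hx, hy]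

/-- The universal property of the algebra. -/
noncomputable def liftTL {n : ℕ} {A : Type*} [Ring A] [Algebra K A] (e : Fin (n + 1) → A)
    (sq : ∀ a, e a * e a = -(qInt 2 • e a))
    (braid : ∀ a b : Fin (n + 1), AdjN a b → e a * e b * e a = e a)
    (comm : ∀ a b : Fin (n + 1), ¬ AdjN a b → e a * e b = e b * e a) : TL n →ₐ[K] A :=
  RingQuot.liftAlgHom K (s := Rel n)
    ⟨FreeAlgebra.lift K e, by
      intro x y hxy
      cases hxy with
      | sq i => simpa using sq i
      | braid i j hij => simpa using braid i j ((dynkin_adj _ _).1 hij)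
      | comm i j hij => simpa using comm i j fun hc => hij ((dynkin_adj _ _).2 hc)⟩

theorem liftTL_E {n : ℕ} {A : Type*} [Ring A] [Algebra K A] (e : Fin (n + 1) → A)
    (sq braid comm) (a : Fin (n + 1)) : liftTL e sq braid comm (E a) = e a := by
  simp [liftTL, E]

/-- The augmentation `E_a ↦ 0`. -/
noncomputable def aug (n : ℕ) : TL n →ₐ[K] K :=
  liftTL (fun _ => 0) (by simp) (by simp) (by simp)

@[simp] theorem aug_E {n : ℕ} (a : Fin (n + 1)) : aug n (E a) = 0 := liftTL_E _ _ _ _ a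

@[simp] theorem aug_EN (n a : ℕ) : aug n (EN n a) = 0 := by
  unfold EN; split_ifs <;> simp

/-- The anti-involution fixing the generators. -/
noncomputable def anti (n : ℕ) : TL n →ₐ[K] (TL n)ᵐᵒᵖ :=
  liftTL (fun a => MulOpposite.op (E a))
    (fun a => by
      rw [← MulOpposite.op_mul, E_sq, MulOpposite.op_neg, MulOpposite.op_smul])
    (fun a b h => by
      rw [← MulOpposite.op_mul, ← MulOpposite.op_mul, ← mul_assoc,
        E_braid ((dynkin_adj _ _).2 h)])
    (fun a b h => by
      rw [← MulOpposite.op_mul, ← MulOpposite.op_mul,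
        E_comm fun hc => h ((dynkin_adj _ _).1 hc)])

theorem anti_E {n : ℕ} (a : Fin (n + 1)) : anti n (E a) = MulOpposite.op (E a) :=
  liftTL_E _ _ _ _ a

theorem aug_anti {n : ℕ} (x : TL n) : aug n (anti n x).unop = aug n x := by
  induction x using TL_induction with
  | scalar c => simp [AlgHom.commutes]
  | gen a => rw [anti_E]; simp
  | mul x y hx hy => rw [map_mul, MulOpposite.unop_mul, map_mul, map_mul, hx, hy, mul_comm]
  | add x y hx hy => rw [map_add, MulOpposite.unop_add, map_add, map_add, hx, hy]

theorem aug_incl {m n : ℕ} (h : m ≤ n) (x : TL m) : aug n (incl h x) = aug m x := by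
  have : (aug n).comp (incl h) = aug m := algHom_ext fun a => by simp [incl_E]
  exact DFunLike.congr_fun this x

theorem incl_self {n : ℕ} (h : n ≤ n) (x : TL n) : incl h x = x := by
  have : incl h = AlgHom.id K (TL n) := algHom_ext fun a => by simp [incl_E]
  exact DFunLike.congr_fun this x

theorem incl_EN {m n a : ℕ} (h : m ≤ n) (ha : a ≤ m) : incl h (EN m a) = EN n a := by
  rw [EN_of_lt (Nat.lt_succ_of_le ha), incl_E, E_eq_EN]
  rfl

theorem mul_eq_aug_smul {n : ℕ} {z : TL n} (hz : ∀ a, E a * z = 0) (x : TL n) :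
    x * z = aug n x • z := by
  induction x using TL_induction with
  | scalar c => simp [Algebra.smul_def]
  | gen a => simp [hz]
  | mul x y hx hy => rw [mul_assoc, hy, mul_smul_comm, hx, map_mul, smul_smul, mul_comm]
  | add x y hx hy => rw [add_mul, hx, hy, map_add, add_smul]

theorem mul_eq_smul_aug {n : ℕ} {z : TL n} (hz : ∀ a, z * E a = 0) (x : TL n) :
    z * x = aug n x • z := by
  induction x using TL_induction with
  | scalar c => simp [Algebra.smul_def, Algebra.commutes]
  | gen a => simp [hz]
  | mul x y hx hy => rw [← mul_assoc, hx, smul_mul_assoc, hy, map_mul, smul_smul]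
  | add x y hx hy => rw [mul_add, hx, hy, map_add, add_smul]

theorem IsJonesWenzl.aug_eq_one {Q : ∀ n, TL n} (hQ : IsJonesWenzl Q) (n : ℕ) :
    aug n (Q n) = 1 := by
  have h := hQ.mul_incl n n le_rfl
  rw [incl_self, mul_eq_aug_smul (hQ.E_mul n)] at h
  exact smul_left_injective K (hQ.ne_zero n) (h.trans (one_smul K _).symm)

/-- The product `Q n * R n` equals `R n` because `R n` is killed on the left, and `Q n` because `Q
n` is killed on the right. -/
theorem IsJonesWenzl.unique {Q R : ∀ n, TL n} (hQ : IsJonesWenzl Q) (hR : IsJonesWenzl R) :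
    Q = R := by
  funext n
  have h1 := mul_eq_aug_smul (hR.E_mul n) (Q n)
  have h2 := mul_eq_smul_aug (hQ.mul_E n) (R n)
  rw [hQ.aug_eq_one, one_smul] at h1
  rw [hR.aug_eq_one, one_smul] at h2
  exact h2.symm.trans h1

/-! ### Existence of the Jones–Wenzl projections -/

/-- Left multiplication by the Hecke generator `E_a + q`. -/
noncomputable def T {n : ℕ} (a : ℕ) (v : TL n) : TL n := EN n a * v + q • v

/-! ### Quadratic and braid relations for the Hecke generators -/

section Hecke

variable {n : ℕ} {a b : ℕ}

theorem T_smul (c : K) (v : TL n) : T a (c • v) = c • T a v := by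
  rw [T, T, mul_smul_comm, smul_add, smul_comm c q]

theorem T_of_kill {v : TL n} (h : EN n a * v = 0) : T a v = q • v := by
  rw [T, h, zero_add]

theorem T_comm (h : ¬ AdjN a b) (v : TL n) : T a (T b v) = T b (T a v) := by
  simp only [T, mul_add, mul_smul_comm, smul_add, ← mul_assoc, EN_comm h]
  abel

theorem EN_mul_EN_mul (v : TL n) : EN n a * (EN n a * v) = (-(q + q⁻¹)) • (EN n a * v) := by
  have h : EN n a * EN n a = (-qInt 2) • EN n a :=
    (EN_sq n a).trans (neg_smul (qInt 2) (EN n a)).symm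
  rw [← mul_assoc, h, smul_mul_assoc, qInt_two]

theorem braid_scalars {F M : Type*} [Field F] [AddCommGroup M] [Module F M] {r : F} (hr : r ≠ 0)
    (x y z t v : M) :
    x + r • y + r • ((-(r + r⁻¹)) • x + r • x) + r • (z + r • t + r • (x + r • v)) =
      r • (y + z) + r ^ 2 • (x + t) + r ^ 3 • v := by
  match_scalars <;> field_simp <;> ring

theorem pair_scalars {F M : Type*} [Field F] [AddCommGroup M] [Module F M] {r : F} (hr : r ≠ 0)
    (x : M) : x + r • ((-(r + r⁻¹)) • x + r • x) = 0 := by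
  match_scalars
  field_simp
  ring

/-- The right side is symmetric in `a` and `b`, which is the braid relation. -/
theorem T_braid_apply (h : AdjN a b) (hb : b ≤ n) (v : TL n) :
    T a (T b (T a v)) = q • (EN n a * (EN n b * v) + EN n b * (EN n a * v)) +
      q ^ 2 • (EN n a * v + EN n b * v) + q ^ 3 • v := by
  have e1 : EN n a * (EN n b * (EN n a * v)) = EN n a * v := by
    rw [← mul_assoc, ← mul_assoc, EN_braid h hb]
  refine Eq.trans ?_ (braid_scalars q_ne_zero (EN n a * v) (EN n a * (EN n b * v)) (EN n b * (EN n a * v))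
    (EN n b * v) v)
  simp only [T, mul_add, mul_smul_comm, smul_add, e1, EN_mul_EN_mul]

theorem T_braid (h : AdjN a b) (ha : a ≤ n) (hb : b ≤ n) (v : TL n) :
    T a (T b (T a v)) = T b (T a (T b v)) := by
  rw [T_braid_apply h hb, T_braid_apply h.symm ha, add_comm (EN n a * (EN n b * v)),
    add_comm (EN n a * v)]

/-- `T_a` has eigenvalues `q` and `-q⁻¹`; the factor `1 + q T_a` removes the second, and the
`q`-eigenspace is the kernel of `E_a`. -/
theorem EN_mul_pair (v : TL n) : EN n a * (v + q • T a v) = 0 := by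
  refine Eq.trans ?_ (pair_scalars q_ne_zero (EN n a * v))
  simp only [T, mul_add, mul_smul_comm, smul_add, EN_mul_EN_mul]

theorem kill_of_T {v : TL n} (h : T a v = q • v) : EN n a * v = 0 := by
  rwa [T, add_eq_right] at h

theorem kill_comm (h : ¬ AdjN a b) {v : TL n} (hv : EN n a * v = 0) : EN n a * T b v = 0 :=
  kill_of_T (by rw [T_comm h, T_of_kill hv, T_smul])

/-- `T_a T_b T_a v = T_b T_a T_b v = q T_b T_a v`: moving past `T_b T_a` turns `E_a` into `E_b`. -/
theorem kill_braid (h : AdjN a b) (ha : a ≤ n) (hb : b ≤ n) {v : TL n} (hv : EN n b * v = 0) :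
    EN n a * T b (T a v) = 0 :=
  kill_of_T (by rw [T_braid h ha hb, T_of_kill hv, T_smul, T_smul])

theorem aug_T (v : TL n) : aug n (T a v) = q * aug n v := by
  simp [T]

end Hecke

/-! ### Summation over minimal coset representatives -/

section Cosets

variable {N : ℕ} (P : TL (N + 1))

/-- The vectors `T_k ⋯ T_n P` with `n = N + 1` and `k = n + 1 - m`, for `m ≤ N`. -/
noncomputable def descVec : ℕ → TL (N + 1)
  | 0 => P
  | m + 1 => T (N + 1 - m) (descVec m)

/-- The vectors `T_{m + 1} ⋯ T_2 T_1 T_0 T_2 ⋯ T_n P`. -/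
noncomputable def ascVec : ℕ → TL (N + 1)
  | 0 => T 1 (T 0 (descVec P N))
  | m + 1 => T (m + 2) (ascVec m)

variable {P}

/-- The bound `m < N` keeps every index used at least 3, so that node 0 also commutes with all of
them. -/
theorem descVec_kill_small (hP : ∀ a ≤ N, EN (N + 1) a * P = 0) :
    ∀ m < N, ∀ a, a ≤ N - m → EN (N + 1) a * descVec P m = 0
  | 0, _, a, ha => hP a (by omega)
  | m + 1, hm, a, ha => by
    rw [descVec]
    exact kill_comm (by unfold AdjN; omega) (descVec_kill_small hP m (by omega) a (by omega))

theorem descVec_kill_large (hP : ∀ a ≤ N, EN (N + 1) a * P = 0) :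
    ∀ m ≤ N, ∀ a, N + 3 - m ≤ a → a ≤ N + 1 → EN (N + 1) a * descVec P m = 0
  | 0, _, a, h1, h2 => by omega
  | m + 1, hm, a, h1, h2 => by
    rcases Nat.lt_or_ge a (N + 3 - m) with h | h
    · obtain ⟨k, rfl⟩ : ∃ k, m = k + 1 := ⟨m - 1, by omega⟩
      have ha : N + 1 - k = a := by omega
      rw [descVec, descVec, ha]
      exact kill_braid (by unfold AdjN; omega) h2 (by omega)
        (descVec_kill_small hP k (by omega) _ (by omega))
    · rw [descVec]
      exact kill_comm (by unfold AdjN; omega) (descVec_kill_large hP m (by omega) a h h2)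

theorem T_descVec_kill (hP : ∀ a ≤ N, EN (N + 1) a * P = 0) {b : ℕ} (hb : b ≤ 1) {a : ℕ}
    (h2 : 2 ≤ a) (ha : a ≤ N + 1) : EN (N + 1) a * T b (descVec P N) = 0 := by
  rcases Nat.eq_or_lt_of_le h2 with rfl | h3
  · obtain ⟨M, rfl⟩ : ∃ M, N = M + 1 := ⟨N - 1, by omega⟩
    rw [descVec, show M + 1 + 1 - M = 2 by omega]
    exact kill_braid (by unfold AdjN; omega) ha (by omega)
      (descVec_kill_small hP M (by omega) _ (by omega))
  · exact kill_comm (by unfold AdjN; omega) (descVec_kill_large hP N le_rfl a (by omega) ha)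

theorem ascVec_kill_large (hP : ∀ a ≤ N, EN (N + 1) a * P = 0) :
    ∀ m a, m + 3 ≤ a → a ≤ N + 1 → EN (N + 1) a * ascVec P m = 0
  | 0, a, h1, h2 => by
    rw [ascVec]
    exact kill_comm (by unfold AdjN; omega) (T_descVec_kill hP (by omega) (by omega) h2)
  | m + 1, a, h1, h2 => by
    rw [ascVec]
    exact kill_comm (by unfold AdjN; omega) (ascVec_kill_large hP m a (by omega) h2)

/-- Either node of the fork can be taken as the last one applied, which makes 0 and 1
interchangeable below. -/
theorem ascVec_zero' : ascVec P 0 = T 0 (T 1 (descVec P N)) :=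
  T_comm (by unfold AdjN; omega) _

theorem ascVec_kill_small (hP : ∀ a ≤ N, EN (N + 1) a * P = 0) :
    ∀ m a, a ≤ m + 1 → m + 1 ≤ N → EN (N + 1) a * ascVec P (m + 1) = 0
  | 0, a, h1, h2 => by
    rcases Nat.le_one_iff_eq_zero_or_eq_one.1 h1 with rfl | rfl
    · rw [ascVec, ascVec_zero']
      exact kill_braid (by unfold AdjN; omega) (by omega) (by omega)
        (T_descVec_kill hP le_rfl (by omega) (by omega))
    · rw [ascVec, ascVec]
      exact kill_braid (by unfold AdjN; omega) (by omega) (by omega)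
        (T_descVec_kill hP (by omega) (by omega) (by omega))
  | m + 1, a, h1, h2 => by
    rcases Nat.eq_or_lt_of_le h1 with rfl | h
    · rw [ascVec, ascVec]
      exact kill_braid (by unfold AdjN; omega) (by omega) (by omega)
        (ascVec_kill_large hP m _ (by omega) (by omega))
    · rw [ascVec]
      exact kill_comm (by unfold AdjN; omega)
        (ascVec_kill_small hP m a (by omega) (by omega))

variable (P)

/-- The sum of `q^ℓ(d) T_d P` over the minimal coset representatives `d`. -/
noncomputable def cosetSum : TL (N + 1) :=
  (∑ m ∈ Finset.range (N + 1), q ^ m • descVec P m) +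
    q ^ (N + 1) • T 1 (descVec P N) + q ^ (N + 1) • T 0 (descVec P N) +
    ∑ m ∈ Finset.range (N + 1), q ^ (N + 2 + m) • ascVec P m

variable {P}

theorem mul_sum_eq_of_pair {A : Type*} [Semiring A] (e : A) (f : ℕ → A) (c n : ℕ) (hc : c + 1 < n)
    (h : ∀ m < n, m ≠ c → m ≠ c + 1 → e * f m = 0) (h2 : e * (f c + f (c + 1)) = 0) :
    e * ∑ m ∈ Finset.range n, f m = 0 := by
  rw [Finset.mul_sum, ← Finset.sum_subset (s₁ := {c, c + 1}), Finset.sum_pair (by omega),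
    ← mul_add, h2]
  · intro x hx
    simp only [Finset.mem_insert, Finset.mem_singleton, Finset.mem_range] at *
    omega
  · intro x hx hx2
    simp only [Finset.mem_insert, Finset.mem_singleton, Finset.mem_range, not_or] at *
    exact h x hx hx2.1 hx2.2

/-- The reflection `s_a` either fixes a coset, and then `E_a` kills its term, or pairs `d` with `s_a
d`, and the two terms cancel by `EN_mul_pair`. There are two pairs: for `a ≥ 2` one in each chain,
for `a ≤ 1` both around the fork. -/
theorem EN_mul_cosetSum (hP : ∀ a ≤ N, EN (N + 1) a * P = 0) {a : ℕ} (ha : a ≤ N + 1) :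
    EN (N + 1) a * cosetSum P = 0 := by
  rcases Nat.lt_or_ge a 2 with h | h
  · have hd : EN (N + 1) a * ∑ m ∈ Finset.range N, q ^ m • descVec P m = 0 := by
      rw [Finset.mul_sum]
      refine Finset.sum_eq_zero fun m hm => ?_
      rw [mul_smul_comm, descVec_kill_small hP m (Finset.mem_range.1 hm) a
        (by have := Finset.mem_range.1 hm; omega), smul_zero]
    have hw : EN (N + 1) a * ∑ m ∈ Finset.range N, q ^ (N + 2 + (m + 1)) • ascVec P (m + 1) = 0 := by
      rw [Finset.mul_sum]
      refine Finset.sum_eq_zero fun m hm => ?_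
      rw [mul_smul_comm, ascVec_kill_small hP m a (by omega)
        (by have := Finset.mem_range.1 hm; omega), smul_zero]
    have key : ∀ b, ascVec P 0 = T a (T b (descVec P N)) → EN (N + 1) a *
        (q ^ N • (descVec P N + q • T a (descVec P N)) +
          q ^ (N + 1) • (T b (descVec P N) + q • T a (T b (descVec P N)))) = 0 := by
      intro b hb
      rw [mul_add, mul_smul_comm, mul_smul_comm, EN_mul_pair, EN_mul_pair, smul_zero, smul_zero,
        add_zero]
    rw [cosetSum, Finset.sum_range_succ, Finset.sum_range_succ']
    simp only [mul_add, hd, hw, zero_add]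
    rcases (show a = 0 ∨ a = 1 by omega) with rfl | rfl
    · have := key 1 ascVec_zero'
      rw [ascVec_zero']
      rw [← this]
      simp only [mul_add, mul_smul_comm, smul_add, smul_smul, ← pow_succ, add_zero]
      abel
    · have := key 0 rfl
      rw [← this, ascVec]
      simp only [mul_add, mul_smul_comm, smul_add, smul_smul, ← pow_succ, add_zero]
      abel
  · have hd : EN (N + 1) a * ∑ m ∈ Finset.range (N + 1), q ^ m • descVec P m = 0 := by
      -- At `m = N + 1 - a` the next operator applied in the descending chain is `T a`.
      refine mul_sum_eq_of_pair _ _ (N + 1 - a) _ (by omega) ?_ ?_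
      · intro m hm h1 h2
        rw [mul_smul_comm]
        rcases Nat.lt_or_ge m (N + 1 - a) with h3 | h3
        · rw [descVec_kill_small hP m (by omega) a (by omega), smul_zero]
        · rw [descVec_kill_large hP m (by omega) a (by omega) ha, smul_zero]
      · rw [descVec, show N + 1 - (N + 1 - a) = a by omega, pow_succ, mul_smul, ← smul_add,
          mul_smul_comm, EN_mul_pair, smul_zero]
    have hw : EN (N + 1) a * ∑ m ∈ Finset.range (N + 1), q ^ (N + 2 + m) • ascVec P m = 0 := by
      obtain ⟨c, rfl⟩ : ∃ c, a = c + 2 := ⟨a - 2, by omega⟩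
      refine mul_sum_eq_of_pair _ _ c _ (by omega) ?_ ?_
      · intro m hm h1 h2
        rw [mul_smul_comm]
        rcases Nat.lt_or_ge m c with h3 | h3
        · rw [ascVec_kill_large hP m _ (by omega) ha, smul_zero]
        · obtain ⟨k, rfl⟩ : ∃ k, m = k + 1 := ⟨m - 1, by omega⟩
          rw [ascVec_kill_small hP k _ (by omega) (by omega), smul_zero]
      · rw [ascVec, ← add_assoc, pow_succ, mul_smul, ← smul_add, mul_smul_comm, EN_mul_pair,
          smul_zero]
    rw [cosetSum, mul_add, mul_add, mul_add, hd, hw, mul_smul_comm, mul_smul_comm,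
      T_descVec_kill hP le_rfl h ha, T_descVec_kill hP (Nat.zero_le 1) h ha]
    simp

theorem aug_descVec (m : ℕ) : aug (N + 1) (descVec P m) = q ^ m * aug (N + 1) P := by
  induction m with
  | zero => simp [descVec]
  | succ m ih => rw [descVec, aug_T, ih]; ring

theorem aug_ascVec (m : ℕ) : aug (N + 1) (ascVec P m) = q ^ (N + 2 + m) * aug (N + 1) P := by
  induction m with
  | zero => rw [ascVec, aug_T, aug_T, aug_descVec]; ring
  | succ m ih => rw [ascVec, aug_T, ih]; ring

/-- At `q = 1` the polynomial counts the cosets, of which there are `2N + 4`. -/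
theorem coset_poincare_ne_zero (N : ℕ) :
    (∑ m ∈ Finset.range (N + 1), q ^ (2 * m)) + 2 * q ^ (2 * N + 2) +
      ∑ m ∈ Finset.range (N + 1), q ^ (2 * (N + 2 + m)) ≠ 0 := by
  set p : Polynomial ℂ := (∑ m ∈ Finset.range (N + 1), Polynomial.X ^ (2 * m)) +
    2 * Polynomial.X ^ (2 * N + 2) +
      ∑ m ∈ Finset.range (N + 1), Polynomial.X ^ (2 * (N + 2 + m)) with hp
  have h1 : algebraMap (Polynomial ℂ) K p = (∑ m ∈ Finset.range (N + 1), q ^ (2 * m)) +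
      2 * q ^ (2 * N + 2) + ∑ m ∈ Finset.range (N + 1), q ^ (2 * (N + 2 + m)) := by
    simp only [hp, map_add, map_sum, map_pow, map_mul, RatFunc.algebraMap_X, map_ofNat]
    rfl
  have h2 : p.eval 1 = ((2 * N + 4 : ℕ) : ℂ) := by
    simp [hp, Polynomial.eval_finsetSum]
    ring
  rw [← h1]
  refine RatFunc.algebraMap_ne_zero fun h => ?_
  rw [h, Polynomial.eval_zero] at h2
  exact absurd h2.symm (Nat.cast_ne_zero.2 (by omega))

theorem aug_cosetSum_ne_zero (hP : aug (N + 1) P ≠ 0) : aug (N + 1) (cosetSum P) ≠ 0 := by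
  have h : aug (N + 1) (cosetSum P) = ((∑ m ∈ Finset.range (N + 1), q ^ (2 * m)) +
      2 * q ^ (2 * N + 2) + ∑ m ∈ Finset.range (N + 1), q ^ (2 * (N + 2 + m))) *
        aug (N + 1) P := by
    simp only [cosetSum, map_add, map_sum, map_smul, aug_T, aug_descVec, aug_ascVec, smul_eq_mul,
      add_mul, Finset.sum_mul]
    congr 1
    · rw [add_assoc]
      congr 1
      · exact Finset.sum_congr rfl fun m _ => by ring
      · ring
    · exact Finset.sum_congr rfl fun m _ => by ring
  rw [h]
  exact mul_ne_zero (coset_poincare_ne_zero N) hP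

end Cosets

theorem exists_left_killed : ∀ n, ∃ x : TL n, aug n x ≠ 0 ∧ ∀ a ≤ n, EN n a * x = 0
  | 0 => by
    refine ⟨1 + q • T 0 1, ?_, ?_⟩
    · rw [map_add, map_smul, aug_T, map_one, smul_eq_mul]
      intro h
      have h2 : q ^ 2 = -1 := by linear_combination h
      exact q_pow_ne_C two_pos (-1) (by rw [h2, map_neg, map_one])
    · intro a ha
      obtain rfl : a = 0 := by omega
      exact EN_mul_pair _
  | N + 1 => by
    obtain ⟨x, hx, hk⟩ := exists_left_killed N
    refine ⟨cosetSum (incl (Nat.le_succ N) x), aug_cosetSum_ne_zero (by rwa [aug_incl]),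
      fun a ha => EN_mul_cosetSum (fun b hb => ?_) ha⟩
    rw [← incl_EN (Nat.le_succ N) hb, ← map_mul, hk b hb, map_zero]

theorem exists_two_sided_killed (n : ℕ) :
    ∃ x : TL n, aug n x = 1 ∧ (∀ a, E a * x = 0) ∧ ∀ a, x * E a = 0 := by
  obtain ⟨x, hx, hk⟩ := exists_left_killed n
  have hk' : ∀ a, E a * x = 0 := fun a => by
    rw [E_eq_EN]; exact hk a (Nat.lt_succ_iff.1 a.2)
  have hr : ∀ a, (anti n x).unop * E a = 0 := fun a => by
    have := congrArg (fun z => (anti n z).unop) (hk' a)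
    simpa [anti_E] using this
  have hz : aug n (x * (anti n x).unop) = aug n x * aug n x := by rw [map_mul, aug_anti]
  refine ⟨(aug n x * aug n x)⁻¹ • (x * (anti n x).unop), ?_, fun a => ?_, fun a => ?_⟩
  · rw [map_smul, hz, smul_eq_mul, inv_mul_cancel₀ (mul_ne_zero hx hx)]
  · rw [mul_smul_comm, ← mul_assoc, hk', zero_mul, smul_zero]
  · rw [smul_mul_assoc, mul_assoc, hr, mul_zero, smul_zero]

theorem isJonesWenzl_of_killed {Q : ∀ n, TL n} (h1 : ∀ n, aug n (Q n) = 1)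
    (hl : ∀ n a, E a * Q n = 0) (hr : ∀ n a, Q n * E a = 0) : IsJonesWenzl Q where
  ne_zero n h := by simpa [h] using h1 n
  mul_incl n i h := by rw [mul_eq_smul_aug (hr n), aug_incl, h1, one_smul]
  incl_mul n i h := by rw [mul_eq_aug_smul (hl n), aug_incl, h1, one_smul]
  E_mul := hl
  mul_E := hr

theorem existsUnique_isJonesWenzl : ∃! Q : ∀ n, TL n, IsJonesWenzl Q := by
  choose Q h1 hl hr using exists_two_sided_killed
  exact ⟨Q, isJonesWenzl_of_killed h1 hl hr,
    fun R hR => hR.unique (isJonesWenzl_of_killed h1 hl hr)⟩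

/-! ### Representations on `K × (ℕ → K)` -/

/-- The sum of the values of `y` at the neighbours of a node of `D_∞`. -/
noncomputable def nbrSum (y : ℕ → K) : ℕ → K
  | 0 => y 2
  | 1 => y 2
  | 2 => y 0 + y 1 + y 3
  | k + 3 => y (k + 2) + y (k + 4)

/-- The coefficient functional of the rank one operator by which `E_a` acts. -/
noncomputable def coeffFun (i a : ℕ) : (K × (ℕ → K)) →ₗ[K] K where
  toFun m := (if a = i then m.1 else 0) - qInt 2 * m.2 a + nbrSum m.2 a
  map_add' m m' := by
    rcases a with _ | _ | _ | a <;> simp only [nbrSum, Prod.fst_add, Prod.snd_add, Pi.add_apply] <;>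
      split_ifs <;> ring
  map_smul' c m := by
    rcases a with _ | _ | _ | a <;> simp only [nbrSum, Prod.smul_fst, Prod.smul_snd, Pi.smul_apply,
      smul_eq_mul, RingHom.id_apply] <;> split_ifs <;> ring

theorem coeffFun_apply (i a : ℕ) (d : K) (y : ℕ → K) :
    coeffFun i a (d, y) = (if a = i then d else 0) - qInt 2 * y a + nbrSum y a := rfl

/-- The basis vector at the node `a`. -/
noncomputable def nodeVec (a : ℕ) : K × (ℕ → K) := (0, Pi.single a 1)

/-- For rank one operators `m ↦ f_a(m) e_a` the defining relations only involve the numbers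
`f_a(e_b)`, computed here and in the next two lemmas. -/
theorem coeffFun_nodeVec_self (i a : ℕ) : coeffFun i a (nodeVec a) = -qInt 2 := by
  rw [nodeVec, coeffFun_apply]
  rcases a with _ | _ | _ | a <;> simp [nbrSum]

theorem coeffFun_nodeVec_adj {i a b : ℕ} (h : AdjN a b) : coeffFun i a (nodeVec b) = 1 := by
  rw [nodeVec, coeffFun_apply]
  unfold AdjN at h
  rcases a with _ | _ | _ | a
  · obtain rfl : b = 2 := by omega
    simp [nbrSum]
  · obtain rfl : b = 2 := by omega
    simp [nbrSum]
  · rcases (show b = 0 ∨ b = 1 ∨ b = 3 by omega) with rfl | rfl | rfl <;> simp [nbrSum]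
  · rcases (show b = a + 2 ∨ b = a + 4 by omega) with rfl | rfl <;> simp [nbrSum]

theorem coeffFun_nodeVec_of_not {i a b : ℕ} (h : ¬ AdjN a b) (hab : a ≠ b) :
    coeffFun i a (nodeVec b) = 0 := by
  rw [nodeVec, coeffFun_apply]
  unfold AdjN at h
  have key : ∀ c, c ≠ b → (Pi.single b 1 : ℕ → K) c = 0 := fun c hc => Pi.single_eq_of_ne hc 1
  rcases a with _ | _ | _ | a <;> simp only [nbrSum]
  · rw [key 0 hab, key 2 (by omega)]; simp
  · rw [key 1 hab, key 2 (by omega)]; simp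
  · rw [key 2 hab, key 0 (by omega), key 1 (by omega), key 3 (by omega)]; simp
  · rw [key (a + 3) hab, key (a + 2) (by omega), key (a + 4) (by omega)]; simp

/-- The operator by which `E_a` acts. -/
noncomputable def nodeOp (i a : ℕ) : Module.End K (K × (ℕ → K)) :=
  (coeffFun i a).smulRight (nodeVec a)

theorem nodeOp_apply (i a : ℕ) (m : K × (ℕ → K)) : nodeOp i a m = coeffFun i a m • nodeVec a := rfl

/-- The left representation spanned by `1` and the monomials of `a`-value one ending in `E_i`. -/
noncomputable def rep (n i : ℕ) : TL n →ₐ[K] Module.End K (K × (ℕ → K)) :=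
  liftTL (fun a => nodeOp i a)
    (fun a => LinearMap.ext fun m => by
      simp [nodeOp_apply, coeffFun_nodeVec_self, smul_smul, mul_comm])
    (fun a b h => LinearMap.ext fun m => by
      simp [nodeOp_apply, coeffFun_nodeVec_adj h, coeffFun_nodeVec_adj h.symm])
    (fun a b h => LinearMap.ext fun m => by
      rcases eq_or_ne a b with rfl | hab
      · rfl
      · have hab' : (a : ℕ) ≠ b := fun hc => hab (Fin.ext hc)
        simp [nodeOp_apply, coeffFun_nodeVec_of_not h hab',
          coeffFun_nodeVec_of_not (fun hc => h hc.symm) hab'.symm])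

theorem rep_E {n : ℕ} (i : ℕ) (a : Fin (n + 1)) (m : K × (ℕ → K)) :
    rep n i (E a) m = coeffFun i a m • nodeVec a := by
  rw [rep, liftTL_E, nodeOp_apply]

/-- The coefficient of the monomial of `a`-value one from `E_j` to `E_i`. -/
noncomputable def coefFun (n i j : ℕ) : TL n →ₗ[K] K :=
  LinearMap.proj j ∘ₗ LinearMap.snd K K (ℕ → K) ∘ₗ LinearMap.applyₗ ((1 : K), (0 : ℕ → K)) ∘ₗ
    (rep n i).toLinearMap

theorem coefFun_apply (n i j : ℕ) (x : TL n) : coefFun n i j x = (rep n i x (1, 0)).2 j := rfl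

/-! ### Words -/

theorem word_cons {n : ℕ} (a : Fin (n + 1)) (w : List (Fin (n + 1))) :
    word (a :: w) = E a * word w := by simp [word]

theorem descending_self {n i : ℕ} (hi : i ≤ n) :
    descending i i hi = [(⟨i, Nat.lt_succ_of_le hi⟩ : Fin (n + 1))] := by
  refine List.ext_getElem (by simp [descending]) fun k h1 h2 => ?_
  have : k = 0 := by simpa using h2
  subst this
  simp [descending]

theorem descending_succ {n i j : ℕ} (hij : i ≤ j) (hj : j + 1 ≤ n) :
    descending i (j + 1) hj = (⟨j + 1, Nat.lt_succ_of_le hj⟩ : Fin (n + 1)) ::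
      descending i j (by omega) := by
  refine List.ext_getElem (by simp [descending]; omega) fun k h1 h2 => ?_
  rcases k with _ | k
  · simp [descending]
  · simp [descending]

theorem length_descending {n i j : ℕ} (hj : j ≤ n) :
    (descending i j hj).length = j + 1 - i := by simp [descending]

theorem rep_word_descending {n i j : ℕ} (hi : 1 ≤ i) (hij : i ≤ j) (hj : j ≤ n) :
    rep n i (word (descending i j hj)) (1, 0) = nodeVec j := by
  induction j, hij using Nat.le_induction with
  | base =>
    rw [descending_self, word_cons, map_mul, Module.End.mul_apply, rep_E]
    rcases i with _ | _ | _ | i <;> simp [word, coeffFun_apply, nbrSum]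
  | succ j hij ih =>
    rw [descending_succ hij, word_cons, map_mul, Module.End.mul_apply, ih (by omega), rep_E,
      coeffFun_nodeVec_adj (by unfold AdjN; exact .inr (.inr (.inr ⟨by omega, rfl⟩))),
      one_smul]

theorem coefFun_word_descending {n i j : ℕ} (hi : 1 ≤ i) (hij : i ≤ j) (hj : j ≤ n) :
    coefFun n i j (word (descending i j hj)) = 1 := by
  rw [coefFun_apply, rep_word_descending hi hij]
  simp [nodeVec]

/-! ### The monomials along the paths that end at a node `i` -/

/-- The product `E_{i + m} ⋯ E_{i + 1} E_i`. -/
noncomputable def pathDown (n i : ℕ) : ℕ → TL n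
  | 0 => EN n i
  | m + 1 => EN n (i + m + 1) * pathDown n i m

/-- The product `E_{i - m} ⋯ E_{i - 1} E_i`. -/
noncomputable def pathUp (n i : ℕ) : ℕ → TL n
  | 0 => EN n i
  | m + 1 => EN n (i - (m + 1)) * pathUp n i m

/-- The product of the generators along the path from `a` to `i ≥ 1`. -/
noncomputable def path (n i a : ℕ) : TL n :=
  if i ≤ a then pathDown n i (a - i)
  else if a = 0 then EN n 0 * (if i ≤ 2 then pathDown n i (2 - i) else pathUp n i (i - 2))
  else pathUp n i (i - a)

theorem path_of_le {n i a : ℕ} (h : i ≤ a) : path n i a = pathDown n i (a - i) := if_pos h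

theorem path_of_ge {n i a : ℕ} (h : a ≤ i) (ha : a ≠ 0) : path n i a = pathUp n i (i - a) := by
  rcases Nat.eq_or_lt_of_le h with rfl | h
  · simp [path, pathDown, pathUp]
  · rw [path, if_neg (by omega), if_neg ha]

theorem path_self (n i : ℕ) : path n i i = EN n i := by simp [path, pathDown]

theorem path_zero {n i : ℕ} (hi : 1 ≤ i) : path n i 0 = EN n 0 * path n i 2 := by
  rw [path, if_neg (by omega), if_pos rfl]
  congr 1

theorem path_succ {n i a : ℕ} (h : i ≤ a) : path n i (a + 1) = EN n (a + 1) * path n i a := by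
  rw [path_of_le (by omega), path_of_le h, show a + 1 - i = (a - i) + 1 by omega, pathDown,
    show i + (a - i) + 1 = a + 1 by omega]

theorem path_pred {n i a : ℕ} (h : a < i) (ha : a ≠ 0) :
    path n i a = EN n a * path n i (a + 1) := by
  rw [path_of_ge h.le ha, path_of_ge h (by omega), show i - a = (i - (a + 1)) + 1 by omega, pathUp,
    show i - (i - (a + 1) + 1) = a by omega]

theorem exists_path_eq {n i : ℕ} (hi : 1 ≤ i) (a : ℕ) : ∃ z, path n i a = EN n a * z := by
  rcases Nat.lt_trichotomy a i with h | rfl | h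
  · rcases Nat.eq_zero_or_pos a with rfl | ha
    · exact ⟨_, path_zero hi⟩
    · exact ⟨_, path_pred h ha.ne'⟩
  · exact ⟨1, by rw [path_self, mul_one]⟩
  · obtain ⟨b, rfl⟩ : ∃ b, a = b + 1 := ⟨a - 1, by omega⟩
    exact ⟨_, path_succ (by omega)⟩

theorem EN_mul_path_self {n i : ℕ} (hi : 1 ≤ i) (a : ℕ) :
    EN n a * path n i a = (-qInt 2) • path n i a := by
  obtain ⟨z, hz⟩ := exists_path_eq (n := n) hi a
  rw [hz, EN_mul_EN_mul, qInt_two]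

theorem EN_mul_path_of_eq {n i a b : ℕ} (hi : 1 ≤ i) (hab : AdjN a b) (hb : b ≤ n)
    (h : path n i b = EN n b * path n i a) : EN n a * path n i b = path n i a := by
  obtain ⟨z, hz⟩ := exists_path_eq (n := n) hi a
  rw [h, hz, ← mul_assoc, ← mul_assoc, EN_braid hab hb]

/-- The diagram is a tree, so a step from `b` to `a` either lengthens the path to `i` or retracts
it; the retraction is `E_a E_b E_a = E_a`. -/
theorem EN_mul_path_adj {n i a b : ℕ} (hi : 1 ≤ i) (hab : AdjN a b) (hb : b ≤ n) :
    EN n a * path n i b = path n i a := by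
  rcases id hab with ⟨rfl, rfl⟩ | ⟨rfl, rfl⟩ | ⟨ha, rfl⟩ | ⟨hb1, rfl⟩
  · exact (path_zero hi).symm
  · exact EN_mul_path_of_eq hi hab hb (path_zero hi)
  · rcases Nat.lt_or_ge a i with h | h
    · exact (path_pred h (by omega)).symm
    · exact EN_mul_path_of_eq hi hab hb (path_succ h)
  · rcases Nat.lt_or_ge b i with h | h
    · exact EN_mul_path_of_eq hi hab hb (path_pred h (by omega))
    · exact (path_succ h).symm

theorem word_descending {n i j : ℕ} (hij : i ≤ j) (hj : j ≤ n) :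
    word (descending i j hj) = path n i j := by
  induction j, hij using Nat.le_induction with
  | base => rw [descending_self, path_self]; simp [word, E_eq_EN]
  | succ j hij ih => rw [descending_succ hij, word_cons, ih (by omega), path_succ hij, E_eq_EN]

/-! ### The coefficient functional on words -/

/-- A word acts on the generating vector by zero unless it is, up to a scalar, the path from its
first letter to `i`; it is then at least as long as the path, and longer if the scalar is not `1`. -/
theorem rep_word_cons {n i : ℕ} (hi : 1 ≤ i) (w : List (Fin (n + 1))) (a : Fin (n + 1)) :
    ∃ c : K, rep n i (word (a :: w)) (1, 0) = c • nodeVec a ∧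
      (c ≠ 0 → word (a :: w) = c • path n i a ∧ max (a : ℕ) 1 ≤ i + w.length ∧
        (c ≠ 1 → max (a : ℕ) 1 < i + w.length)) := by
  induction w generalizing a with
  | nil =>
    refine ⟨if (a : ℕ) = i then 1 else 0, ?_, fun hc => ?_⟩
    · rw [word_cons, map_mul, Module.End.mul_apply, rep_E]
      congr 1
      obtain ⟨a, ha⟩ := a
      rcases a with _ | _ | _ | a <;> simp [word, coeffFun_apply, nbrSum]
    · have ha : (a : ℕ) = i := by by_contra h; simp [h] at hc
      rw [if_pos ha]
      refine ⟨?_, by simp; omega, fun h => absurd rfl h⟩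
      rw [one_smul, ha, path_self, ← ha, ← E_eq_EN]
      simp [word]
  | cons b w ih =>
    obtain ⟨c, hc1, hc2⟩ := ih b
    refine ⟨c * coeffFun i a (nodeVec b), ?_, fun hc => ?_⟩
    · rw [word_cons, map_mul, Module.End.mul_apply, hc1, rep_E, map_smul, smul_eq_mul]
    · obtain ⟨h1, h2, h3⟩ := hc2 (left_ne_zero_of_mul hc)
      rw [List.length_cons, word_cons, h1, mul_smul_comm, E_eq_EN, mul_smul]
      -- The level `max a 1` puts both fork nodes at height 1, so one letter raises it by at most 1.
      -- A repeated letter brings the factor `-[2]` without raising it, hence the strict inequality.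
      rcases eq_or_ne a b with rfl | hab
      · rw [coeffFun_nodeVec_self, EN_mul_path_self hi]
        exact ⟨rfl, by omega, fun _ => by omega⟩
      · by_cases hadj : AdjN a b
        · rw [coeffFun_nodeVec_adj hadj, EN_mul_path_adj hi hadj (Nat.lt_succ_iff.1 b.2), one_smul,
            mul_one]
          unfold AdjN at hadj
          exact ⟨rfl, by omega, fun h => by have := h3 h; omega⟩
        · exact absurd (coeffFun_nodeVec_of_not hadj fun h => hab (Fin.ext h))
            (right_ne_zero_of_mul hc)

theorem coefFun_word {n i j : ℕ} (hi : 1 ≤ i) (hij : i ≤ j) (w : List (Fin (n + 1)))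
    (h : coefFun n i j (word w) ≠ 0) :
    word w = coefFun n i j (word w) • path n i j ∧ j + 1 - i ≤ w.length ∧
      (coefFun n i j (word w) ≠ 1 → j + 1 - i < w.length) := by
  rcases w with _ | ⟨a, w⟩
  · exact absurd (by simp [word, coefFun_apply]) h
  · obtain ⟨c, h1, h2⟩ := rep_word_cons hi w a
    have h3 : coefFun n i j (word (a :: w)) = if (a : ℕ) = j then c else 0 := by
      rw [coefFun_apply, h1]
      simp [nodeVec, Pi.single_apply, eq_comm]
    rw [h3] at h ⊢
    have ha : (a : ℕ) = j := by by_contra ha; simp [ha] at h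
    rw [if_pos ha] at h ⊢
    obtain ⟨h4, h5, h6⟩ := h2 h
    rw [ha] at h4 h5 h6
    refine ⟨h4, by simp; omega, fun hc => ?_⟩
    have := h6 hc
    simp
    omega

theorem isReduced_descending {n i j : ℕ} (hi : 1 ≤ i) (hij : i ≤ j) (hj : j ≤ n) :
    IsReduced (descending i j hj) := by
  intro v c hv
  have h := congrArg (coefFun n i j) hv
  rw [coefFun_word_descending hi hij, map_smul, smul_eq_mul] at h
  have h2 : coefFun n i j (word v) ≠ 0 := fun h0 => by simp [h0] at h
  rw [length_descending]
  exact (coefFun_word hi hij v h2).2.1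

open Classical in
-- A reduced word with nonzero value is a multiple of the path product, hence no longer than it; a
-- scalar other than 1 would force it to be strictly longer.
theorem coefFun_monomial {n i j : ℕ} (hi : 1 ≤ i) (hij : i ≤ j) (hj : j ≤ n) {m : TL n}
    (hm : m ∈ monomials n) :
    coefFun n i j m = if m = word (descending i j hj) then 1 else 0 := by
  split_ifs with h
  · rw [h, coefFun_word_descending hi hij]
  · obtain ⟨w, hw, rfl⟩ := hm
    by_contra h0
    obtain ⟨h1, h2, h3⟩ := coefFun_word hi hij w h0
    rw [← word_descending hij hj] at h1
    have h4 := hw _ _ h1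
    rw [length_descending] at h4
    have h5 : coefFun n i j (word w) = 1 := by
      by_contra hc
      have := h3 hc
      omega
    rw [h5, one_smul] at h1
    exact h h1

theorem exists_isReduced {n : ℕ} (w : List (Fin (n + 1))) :
    ∃ (v : List (Fin (n + 1))) (c : K), IsReduced v ∧ word w = c • word v := by
  induction hl : w.length using Nat.strong_induction_on generalizing w with
  | _ l ih =>
    by_cases hw : IsReduced w
    · exact ⟨w, 1, hw, (one_smul _ _).symm⟩
    · unfold IsReduced at hw
      push Not at hw
      obtain ⟨v, c, h1, h2⟩ := hw
      obtain ⟨u, d, h3, h4⟩ := ih v.length (by omega) v rfl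
      exact ⟨u, c * d, h3, by rw [h1, h4, smul_smul]⟩

theorem word_mem_span {n : ℕ} (w : List (Fin (n + 1))) :
    word w ∈ Submodule.span K (monomials n) := by
  obtain ⟨v, c, hv, h⟩ := exists_isReduced w
  rw [h]
  exact Submodule.smul_mem _ _ (Submodule.subset_span ⟨v, hv, rfl⟩)

theorem mul_word_mem_span {n : ℕ} (x : TL n) :
    ∀ y ∈ Submodule.span K (Set.range (word (n := n))),
      x * y ∈ Submodule.span K (Set.range (word (n := n))) := by
  induction x using TL_induction with
  | scalar c =>
    intro y hy
    rw [← Algebra.smul_def]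
    exact Submodule.smul_mem _ _ hy
  | gen a =>
    intro y hy
    induction hy using Submodule.span_induction with
    | mem y h =>
      obtain ⟨w, rfl⟩ := h
      exact Submodule.subset_span ⟨a :: w, word_cons a w⟩
    | zero => rw [mul_zero]; exact Submodule.zero_mem _
    | add y z _ _ hy hz => rw [mul_add]; exact Submodule.add_mem _ hy hz
    | smul c y _ hy => rw [mul_smul_comm]; exact Submodule.smul_mem _ _ hy
  | mul x x' hx hx' => intro y hy; rw [mul_assoc]; exact hx _ (hx' _ hy)
  | add x x' hx hx' => intro y hy; rw [add_mul]; exact Submodule.add_mem _ (hx _ hy) (hx' _ hy)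

theorem span_monomials {n : ℕ} (x : TL n) : x ∈ Submodule.span K (monomials n) := by
  have h := mul_word_mem_span x 1 (Submodule.subset_span ⟨[], by simp [word]⟩)
  rw [mul_one] at h
  refine Submodule.span_le.2 ?_ h
  rintro _ ⟨w, rfl⟩
  exact word_mem_span w

theorem hasCoef_word_descending {n i j : ℕ} (hi : 1 ≤ i) (hij : i ≤ j) (hj : j ≤ n) (x : TL n) :
    HasCoef x (word (descending i j hj)) (coefFun n i j x) := by
  have hmem : word (descending i j hj) ∈ monomials n := ⟨_, isReduced_descending hi hij hj, rfl⟩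
  refine ⟨hmem, ?_, ?_⟩
  · have h := span_monomials x
    rw [← Set.image_id (monomials n), Finsupp.mem_span_image_iff_linearCombination] at h
    exact h
  · rintro f hf rfl
    rw [Finsupp.linearCombination_apply, Finsupp.sum, map_sum]
    rw [Finset.sum_eq_single (word (descending i j hj))]
    · rw [map_smul, id, coefFun_word_descending hi hij, smul_eq_mul, mul_one]
    · intro m hm hne
      rw [map_smul, id, coefFun_monomial hi hij hj (hf hm), if_neg hne, smul_zero]
    · intro h
      rw [Finsupp.notMem_support_iff.1 h, zero_smul, map_zero]

/-! ### The coefficients of the Jones–Wenzl projections -/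

theorem rep_eq_aug_smul {n i : ℕ} {m : K × (ℕ → K)} (hm : ∀ a ≤ n, coeffFun i a m = 0)
    (x : TL n) : rep n i x m = aug n x • m := by
  induction x using TL_induction with
  | scalar c => simp [Module.algebraMap_end_apply]
  | gen a => rw [rep_E, hm a (Nat.lt_succ_iff.1 a.2)]; simp
  | mul x y hx hy => rw [map_mul, Module.End.mul_apply, hy, map_smul, hx, smul_smul, map_mul, mul_comm]
  | add x y hx hy => rw [map_add, LinearMap.add_apply, hx, hy, map_add, add_smul]

theorem coefFun_eq_of_killed {n i j : ℕ} {Q : TL n} (h1 : aug n Q = 1) (hr : ∀ a, Q * E a = 0)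
    {y : ℕ → K} (hy : ∀ a ≤ n, coeffFun i a (1, y) = 0) (hy0 : ∀ a, n < a → y a = 0) :
    coefFun n i j Q = y j := by
  have hnode : ∀ a ≤ n, rep n i Q (nodeVec a) = 0 := by
    intro a ha
    -- `e_a` is an eigenvector of `E_a` with nonzero eigenvalue `-[2]`, so `Q E_a = 0` forces `Q e_a
    -- = 0`.
    have h := congrArg (fun x => rep n i x (nodeVec a)) (hr ⟨a, Nat.lt_succ_of_le ha⟩)
    simp only [map_mul, Module.End.mul_apply, rep_E, map_smul, coeffFun_nodeVec_self, map_zero,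
      LinearMap.zero_apply] at h
    exact (smul_eq_zero.1 h).resolve_left (neg_ne_zero.2 qInt_two_ne_zero)
  have hsum : ((0 : K), y) = ∑ a ∈ Finset.range (n + 1), y a • nodeVec a := by
    refine Prod.ext ?_ (funext fun b => ?_)
    · simp [Prod.fst_sum, nodeVec]
    · simp only [Prod.snd_sum, Finset.sum_apply, nodeVec, Prod.smul_snd, Pi.smul_apply,
        Pi.single_apply, smul_eq_mul, mul_ite, mul_one, mul_zero, Finset.sum_ite_eq,
        Finset.mem_range]
      split_ifs with hb
      · rfl
      · exact hy0 b (by omega)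
  have hzero : rep n i Q (0, y) = 0 := by
    rw [hsum, map_sum]
    refine Finset.sum_eq_zero fun a ha => ?_
    rw [map_smul, hnode a (by have := Finset.mem_range.1 ha; omega), smul_zero]
  have h := rep_eq_aug_smul hy Q
  rw [h1, one_smul, show ((1 : K), y) = (1, 0) + (0, y) by simp, map_add, hzero, add_zero] at h
  rw [coefFun_apply, h]
  simp

/-! ### Identities of `q`-integers and the inverse of the `q`-Cartan matrix -/

theorem qInt_natCast (n : ℕ) : qInt n = (q ^ n - (q ^ n)⁻¹) / (q - q⁻¹) := by
  rw [qInt, zpow_neg, zpow_natCast]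

theorem qInt_zero : qInt 0 = 0 := by simp [qInt]

theorem qInt_natCast_ne_zero {n : ℕ} (hn : 0 < n) : qInt n ≠ 0 := by
  rw [qInt_natCast]
  exact div_ne_zero (q_pow_sub_inv_ne_zero hn) q_sub_inv_ne_zero

theorem qInt_succ_add_pred (k : ℤ) : qInt (k + 1) + qInt (k - 1) = qInt 2 * qInt k := by
  have h0 := q_ne_zero
  rw [qInt_two]
  simp only [qInt, neg_add, neg_sub, zpow_add₀ h0, zpow_sub₀ h0, zpow_neg, zpow_one]
  ring

/-- `q^n + q^(-n)`. -/
noncomputable def qSum (n : ℕ) : K := q ^ n + (q ^ n)⁻¹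

theorem qSum_ne_zero (n : ℕ) : qSum n ≠ 0 := q_pow_add_inv_ne_zero n

theorem qSum_add_two (n : ℕ) : qSum (n + 2) + qSum n = qInt 2 * qSum (n + 1) := by
  have h0 := q_ne_zero
  rw [qInt_two, qSum, qSum, qSum]
  field_simp
  ring

theorem qInt_two_mul_natCast (n : ℕ) : qInt (2 * n) = qInt n * qSum n := by
  rw [qInt_natCast, qSum, show (2 * (n : ℤ)) = ((2 * n : ℕ) : ℤ) by push_cast; rfl, qInt_natCast,
    mul_comm 2 n, pow_mul]
  field_simp
  ring

/-- A discrete Wronskian of the two homogeneous solutions; it normalizes the inverse matrix on the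
diagonal. -/
theorem qSum_mul_qInt_sub (m k : ℕ) :
    qSum (m + 1) * qInt (k + 1) - qSum m * qInt k = qSum (m + k + 1) := by
  have h0 := q_ne_zero
  rw [← Nat.cast_succ, qInt_natCast, qInt_natCast, mul_div_assoc', mul_div_assoc', ← sub_div,
    div_eq_iff q_sub_inv_ne_zero]
  simp only [qSum, Nat.succ_eq_add_one, pow_succ, pow_add]
  field_simp
  ring

theorem qInt_succ_sub_pred (n : ℕ) : qInt (n + 1) - qInt (n - 1) = qSum n := by
  have h0 := q_ne_zero
  rw [qInt, qInt, ← sub_div, div_eq_iff q_sub_inv_ne_zero, qSum]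
  simp only [neg_add, neg_sub, zpow_add₀ h0, zpow_sub₀ h0, zpow_neg, zpow_one, zpow_natCast]
  ring

/-- The factor of the inverse of the `q`-Cartan matrix that depends on the smaller index. -/
noncomputable def smallFactor : ℕ → K
  | 0 => 1
  | 1 => 1
  | k + 2 => qSum (k + 1)

/-- The column of index `i ≥ 1` of the inverse of the `q`-Cartan matrix of type `D_{n+1}`. -/
noncomputable def column (n i a : ℕ) : K :=
  if i = 1 ∧ a = 0 then qInt (n - 1) / (qInt 2 * qSum n)
  else if i = 1 ∧ a = 1 then qInt (n + 1) / (qInt 2 * qSum n)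
  else smallFactor (min a i) * qInt (n + 1 - (max a i : ℕ)) / qSum n

theorem column_of_le {n i a : ℕ} (hi : 2 ≤ i) (h : a ≤ i) :
    column n i a = smallFactor a * qInt (n + 1 - i) / qSum n := by
  rw [column, if_neg (by omega), if_neg (by omega), min_eq_left h, max_eq_right h]

theorem column_of_ge {n i a : ℕ} (ha : 2 ≤ a) (h : i ≤ a) :
    column n i a = smallFactor i * qInt (n + 1 - a) / qSum n := by
  rw [column, if_neg (by omega), if_neg (by omega), min_eq_right h, max_eq_left h]

theorem column_one_zero (n : ℕ) : column n 1 0 = qInt (n - 1) / (qInt 2 * qSum n) := by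
  simp [column]

theorem column_one_one (n : ℕ) : column n 1 1 = qInt (n + 1) / (qInt 2 * qSum n) := by
  simp [column]

/-- The boundary condition at the free end: the recursion on the infinite diagram is then also
correct at the last node `n`. -/
theorem column_succ_n {n i : ℕ} (hi : i ≤ n) (hn : 1 ≤ n) : column n i (n + 1) = 0 := by
  rw [column_of_ge (by omega) (by omega)]
  simp [qInt_zero]

theorem coeffFun_column_one {n : ℕ} (a : ℕ) : coeffFun 1 a (1, column n 1) = 0 := by
  have hs := qSum_ne_zero n
  have h2 := qInt_two_ne_zero
  have hS := qInt_succ_sub_pred n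
  rw [coeffFun_apply]
  rcases a with _ | _ | _ | a
  · rw [nbrSum, column_one_zero, column_of_ge le_rfl one_le_two]
    simp only [smallFactor, Nat.cast_ofNat, if_neg zero_ne_one]
    rw [show (n : ℤ) + 1 - 2 = n - 1 by ring]
    field_simp
    ring
  · rw [nbrSum, column_one_one, column_of_ge le_rfl one_le_two]
    simp only [smallFactor, Nat.cast_ofNat]
    rw [show (n : ℤ) + 1 - 2 = n - 1 by ring, if_pos trivial]
    field_simp
    linear_combination -hS
  · rw [nbrSum, column_one_zero, column_one_one, column_of_ge le_rfl one_le_two,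
      column_of_ge (by omega) (by omega)]
    have h3 := qInt_succ_add_pred n
    have h4 := qInt_succ_add_pred (n - 1)
    rw [sub_add_cancel] at h4
    simp only [smallFactor, Nat.cast_ofNat]
    rw [show (n : ℤ) + 1 - 2 = n - 1 by ring, show (n : ℤ) + 1 - 3 = n - 1 - 1 by ring,
      if_neg (by omega)]
    field_simp
    linear_combination h3 + qInt 2 * h4
  · rw [nbrSum, column_of_ge (by omega) (by omega), column_of_ge (by omega) (by omega),
      column_of_ge (by omega) (by omega), if_neg (by omega)]
    have h3 := qInt_succ_add_pred (n + 1 - (a + 3 : ℕ))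
    rw [show (n : ℤ) + 1 - (a + 2 : ℕ) = n + 1 - (a + 3 : ℕ) + 1 by push_cast; ring,
      show (n : ℤ) + 1 - (a + 4 : ℕ) = n + 1 - (a + 3 : ℕ) - 1 by push_cast; ring]
    simp only [smallFactor]
    field_simp
    linear_combination h3

theorem nbrSum_smallFactor (a : ℕ) : nbrSum smallFactor a = qInt 2 * smallFactor a := by
  have h2 : qSum 1 = qInt 2 := by rw [qInt_two, qSum, pow_one]
  have h0 : qSum 0 = 2 := by rw [qSum, pow_zero, inv_one]; norm_num
  rcases a with _ | _ | _ | a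
  · simp [nbrSum, smallFactor, h2]
  · simp [nbrSum, smallFactor, h2]
  · simp only [nbrSum, smallFactor]
    -- The two fork values `1 + 1` play the role of `qSum 0 = 2`.
    linear_combination qSum_add_two 0 - h0
  · simp only [nbrSum, smallFactor]
    linear_combination qSum_add_two (a + 1)

theorem nbrSum_smul (c : K) (y : ℕ → K) (a : ℕ) :
    nbrSum (fun b => y b * c) a = nbrSum y a * c := by
  rcases a with _ | _ | _ | a <;> simp only [nbrSum] <;> ring

/-- Two functions that agree up to `a + 1` have the same neighbour sum at `a`. -/
theorem nbrSum_congr {y z : ℕ → K} {a : ℕ} (ha : 1 ≤ a) (h : ∀ b ≤ a + 1, y b = z b) :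
    nbrSum y a = nbrSum z a := by
  rcases a with _ | _ | _ | a
  · omega
  · simp only [nbrSum]; rw [h _ (by omega)]
  · simp only [nbrSum]; rw [h _ (by omega), h _ (by omega), h _ (by omega)]
  · simp only [nbrSum]; rw [h _ (by omega), h _ (by omega)]

/-- A Green's function: `smallFactor` solves the homogeneous equation from the fork, `[n + 1 - a]`
from the free end, and they are glued at `i`. Off the diagonal only one solution is seen; at `a = i`
the defect is the Wronskian over `qSum n`, which is 1. -/
theorem coeffFun_column {n i : ℕ} (hi : 2 ≤ i) (hin : i ≤ n) (a : ℕ) :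
    coeffFun i a (1, column n i) = 0 := by
  have hs := qSum_ne_zero n
  have hbelow : ∀ b ≤ i, column n i b = smallFactor b * (qInt (n + 1 - i) / qSum n) :=
    fun b hb => by rw [column_of_le hi hb, mul_div_assoc]
  rw [coeffFun_apply]
  rcases Nat.lt_trichotomy a i with h | rfl | h
  · have h1 : nbrSum (column n i) a =
        nbrSum (fun b => smallFactor b * (qInt (n + 1 - i) / qSum n)) a := by
      rcases Nat.eq_zero_or_pos a with rfl | ha
      · exact hbelow 2 hi
      · exact nbrSum_congr ha fun b hb => hbelow b (by omega)
    rw [h1, nbrSum_smul, nbrSum_smallFactor, hbelow a h.le, if_neg (by omega)]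
    ring
  -- The column and the continuation of its lower branch have the same values at the neighbours of
  -- `a` except at `a + 1`.
  · have h1 : nbrSum (column n a) a + smallFactor (a + 1) * (qInt (n + 1 - a) / qSum n) =
        nbrSum (fun b => smallFactor b * (qInt (n + 1 - a) / qSum n)) a + column n a (a + 1) := by
      rcases a with _ | _ | _ | a
      · omega
      · omega
      · simp only [nbrSum]; rw [hbelow 0 (by omega), hbelow 1 (by omega)]; ring
      · simp only [nbrSum]; rw [hbelow _ (by omega)]; ring
    rw [nbrSum_smul, nbrSum_smallFactor, column_of_ge (by omega) (by omega)] at h1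
    rw [hbelow a le_rfl, if_pos rfl]
    obtain ⟨k, rfl⟩ : ∃ k, n = a + k := ⟨n - a, by omega⟩
    obtain ⟨m, rfl⟩ : ∃ m, a = m + 2 := ⟨a - 2, by omega⟩
    have h3 := qSum_mul_qInt_sub (m + 1) k
    rw [show m + 1 + k + 1 = m + 2 + k by omega] at h3
    rw [show ((m + 2 + k : ℕ) : ℤ) + 1 - (m + 2 : ℕ) = k + 1 by push_cast; ring] at h1 ⊢
    rw [show ((m + 2 + k : ℕ) : ℤ) + 1 - (m + 2 + 1 : ℕ) = k by push_cast; ring] at h1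
    simp only [smallFactor] at h1 ⊢
    have h4 : (1 : K) = (qSum (m + 1 + 1) * qInt (k + 1) - qSum (m + 1) * qInt k) /
        qSum (m + 2 + k) := by rw [h3, div_self hs]
    linear_combination h1 + h4
  · obtain ⟨c, rfl⟩ : ∃ c, a = c + 3 := ⟨a - 3, by omega⟩
    rw [nbrSum, column_of_ge (by omega) (by omega), column_of_ge (by omega) (by omega),
      column_of_ge (by omega) (by omega), if_neg (by omega)]
    have h3 := qInt_succ_add_pred (n + 1 - (c + 3 : ℕ))
    rw [show (n : ℤ) + 1 - (c + 2 : ℕ) = n + 1 - (c + 3 : ℕ) + 1 by push_cast; ring,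
      show (n : ℤ) + 1 - (c + 4 : ℕ) = n + 1 - (c + 3 : ℕ) - 1 by push_cast; ring]
    field_simp
    linear_combination smallFactor i * h3

theorem coefFun_eq_column {n i j : ℕ} (hi : 1 ≤ i) (hij : i ≤ j) (hj : j ≤ n) {Q : TL n}
    (h1 : aug n Q = 1) (hr : ∀ a, Q * E a = 0) : coefFun n i j Q = column n i j := by
  have hcol : ∀ a, coeffFun i a (1, column n i) = 0 := by
    rcases Nat.eq_or_lt_of_le hi with rfl | hi2
    · exact coeffFun_column_one
    · exact coeffFun_column hi2 (by omega)
  -- The closed formula need not vanish beyond `n + 1`, so it is cut off; no equation at a node `≤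
  -- n` changes, since the neighbours are at most `n + 1` (for node 0 because `n ≥ 1`).
  set y : ℕ → K := fun a => if a ≤ n then column n i a else 0 with hy
  have hle : ∀ a ≤ n + 1, y a = column n i a := by
    intro a ha
    rcases Nat.eq_or_lt_of_le ha with rfl | h
    · rw [column_succ_n (by omega) (by omega)]; simp [hy]
    · exact if_pos (by omega)
  have h := coefFun_eq_of_killed (i := i) (j := j) h1 hr (y := y) (fun a ha => ?_)
    (fun a ha => if_neg (by omega))
  · rw [h, hle j (by omega)]
  · have hn : nbrSum y a = nbrSum (column n i) a := by
      rcases Nat.eq_zero_or_pos a with rfl | h0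
      · exact hle 2 (by omega)
      · exact nbrSum_congr h0 fun b hb => hle b (by omega)
    rw [coeffFun_apply, hn, hle a (by omega)]
    exact hcol a

/-- Everything comes from `[2k] = [k] (q^k + q^(-k))`, applied with `k = n` and, for `i ≥ 2`, with
`k = i - 1`. -/
theorem column_eq {n i j : ℕ} (hi : 1 ≤ i) (hij : i ≤ j) (hj : j ≤ n) :
    column n i j =
      if i = 1 ∧ j = 1 then qInt n * qInt (n + 1) / (qInt (2 * n) * qInt 2)
      else if i = 1 then qInt n * qInt (n + 1 - j) / qInt (2 * n)
      else qInt n * qInt (2 * (i - 1)) * qInt (n + 1 - j) / (qInt (2 * n) * qInt (i - 1)) := by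
  have hs := qSum_ne_zero n
  have hn : qInt n ≠ 0 := qInt_natCast_ne_zero (by omega)
  have h2 := qInt_two_ne_zero
  rw [qInt_two_mul_natCast]
  split_ifs with h h'
  · obtain ⟨rfl, rfl⟩ := h
    rw [column_one_one]
    field_simp
  · subst h'
    rw [column_of_ge (by omega) hij, smallFactor]
    field_simp
  · obtain ⟨k, rfl⟩ : ∃ k, i = k + 2 := ⟨i - 2, by omega⟩
    have hk : qInt (k + 1 : ℕ) ≠ 0 := qInt_natCast_ne_zero (by omega)
    rw [column_of_ge (by omega) hij, smallFactor,
      show ((k + 2 : ℕ) : ℤ) - 1 = (k + 1 : ℕ) by push_cast; ring, qInt_two_mul_natCast]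
    field_simp

end TypeD

theorem mainTheorem8 :
    (∃! Q : ∀ n : ℕ, TypeD.TL n, TypeD.IsJonesWenzl Q) ∧
    ∀ Q : ∀ n : ℕ, TypeD.TL n, TypeD.IsJonesWenzl Q →
      ∀ (n i j : ℕ) (_ : 1 ≤ i) (_ : i ≤ j) (hj : j ≤ n),
        TypeD.HasCoef (Q n) (TypeD.word (TypeD.descending i j hj))
          (if i = 1 ∧ j = 1 then
            TypeD.qInt n * TypeD.qInt (n + 1) / (TypeD.qInt (2 * n) * TypeD.qInt 2)
          else if i = 1 then
            TypeD.qInt n * TypeD.qInt (n + 1 - j) / TypeD.qInt (2 * n)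
          else
            TypeD.qInt n * TypeD.qInt (2 * (i - 1)) * TypeD.qInt (n + 1 - j) /
              (TypeD.qInt (2 * n) * TypeD.qInt (i - 1))) := by
  refine ⟨TypeD.existsUnique_isJonesWenzl, fun Q hQ n i j hi hij hj => ?_⟩
  rw [← TypeD.column_eq hi hij hj,
    ← TypeD.coefFun_eq_column hi hij hj (hQ.aug_eq_one n) (hQ.mul_E n)]
  exact TypeD.hasCoef_word_descending hi hij hj (Q n)
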